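/- Let $d\ge 1$ be an integer, let $\psi(x)=e^{-|x|^2/4}$ for $x\in\mathbb R^d$, and let $e^{it\Delta}\psi$ denote the solution at time $t$ of the free Schrödinger equation $i\partial_t u=-\Delta u$ on $\mathbb R^d$ with initial data $\psi$. For $\lambda>0$ put $$\mu(\lambda)=\bigl|\{(t,x)\in\mathbb R\times\mathbb R^d:\ |e^{it\Delta}\psi(x)|^2>\lambda\}\bigr|$$ (Lebesgue measure). Let $c\ge 1+\frac{3}{2d}$, $v(k)=e^{-ck}\mu(e^{-k})$ and $V(z)=\int_0^\infty e^{-kz}v(k)\,dk$ for $z\in\mathbb H=\{z\in\mathbb C:\operatorname{Re}z>0\}$. Then $\mu(\lambda)<\infty$ for every $\lambda>0$, the integral defining $V(z)$ converges absolutely for every $z\in\mathbb H$, and $V$ belongs to the Hardy space $H^2(\mathbb H)$, that is, $V$ is analytic in $\mathbb H$ and $$\sup_{x>0}\int_{\mathbb R}|V(x+iy)|^2\,dy<\infty .$$ Moreover $V$ is an outer function: the boundary values $V(iy)=\lim_{x\downarrow0}V(x+iy)$ exist and are non-zero for almost every $y\in\mathbb R$, $\int_{\mathbb R}\bigl|\log|V(iy)|\bigr|\frac{dy}{1+y^2}<\infty$,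 and $|V(z)|=|O_V(z)|$ for all $z\in\mathbb H$, where $$O_V(z)=\exp\Bigl\{\int_{\mathbb R}\log|V(it)|\Bigl[\frac1{z-it}-\frac{it}{1+t^2}\Bigr]\frac{dt}{\pi}\Bigr\}.$$ -/

import Mathlib

open MeasureTheory Filter Topology
open scoped ENNReal FourierTransform

noncomputable section

/-- The free Schrödinger propagator `e^{itΔ}` on `ℝ^d`, as a Fourier multiplier (for `f` with `f` and
its Fourier transform integrable). With the normalization `𝓕 f ξ = ∫ e^{-2πi⟨x,ξ⟩} f x dx`, the
Laplacian is multiplication by `-4π²|ξ|²`. -/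
def schrodingerPropagator {d : ℕ} (t : ℝ) (f : EuclideanSpace ℝ (Fin d) → ℂ) :
    EuclideanSpace ℝ (Fin d) → ℂ :=
  𝓕⁻ (fun ξ : EuclideanSpace ℝ (Fin d) =>
    Complex.exp (-(4 * (Real.pi : ℂ) ^ 2 * Complex.I * (t : ℂ) * ((‖ξ‖ ^ 2 : ℝ) : ℂ))) * 𝓕 f ξ)

/-- The Gaussian `ψ(x) = exp(-|x|²/4)`. -/
def gaussianData (d : ℕ) (x : EuclideanSpace ℝ (Fin d)) : ℂ :=
  ((Real.exp (-(‖x‖ ^ 2) / 4) : ℝ) : ℂ)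

/-- The distribution function
`μ(lam) = |{(t,x) ∈ ℝ × ℝ^d : |e^{itΔ}ψ(x)|² > lam}|`. -/
def gaussianDistribution (d : ℕ) (lam : ℝ) : ℝ≥0∞ :=
  volume {p : ℝ × EuclideanSpace ℝ (Fin d) |
    lam < ‖schrodingerPropagator p.1 (gaussianData d) p.2‖ ^ 2}

/-- `v(k) = e^{-ck} μ(e^{-k})`. -/
def weightFunction (d : ℕ) (c : ℝ) (k : ℝ) : ℝ :=
  Real.exp (-(c * k)) * (gaussianDistribution d (Real.exp (-k))).toReal

/-- The Laplace transform `V(z) = ∫₀^∞ e^{-kz} v(k) dk`. -/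
def laplaceTransform (v : ℝ → ℝ) (z : ℂ) : ℂ :=
  ∫ k in Set.Ioi (0 : ℝ), Complex.exp (-((k : ℂ) * z)) * (v k : ℂ)

/-- The open right half-plane. -/
def rightHalfPlane : Set ℂ := {z : ℂ | 0 < z.re}

/-- Membership in the Hardy space `H²` of the right half-plane. -/
def MemHardyTwo (V : ℂ → ℂ) : Prop :=
  DifferentiableOn ℂ V rightHalfPlane ∧
    (⨆ (x : ℝ) (_ : 0 < x), ∫⁻ y : ℝ, ‖V ((x : ℂ) + (y : ℂ) * Complex.I)‖ₑ ^ 2) < ⊤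

/-- `b` is (a representative of) the boundary function `y ↦ V(iy) = lim_{x ↓ 0} V(x + iy)`, a.e. -/
def IsBoundaryValue (V : ℂ → ℂ) (b : ℝ → ℂ) : Prop :=
  ∀ᵐ y : ℝ, Tendsto (fun x : ℝ => V ((x : ℂ) + (y : ℂ) * Complex.I)) (𝓝[>] 0) (𝓝 (b y))

/-- The analytic function whose log-modulus is the Poisson integral of `log |b|`:
`exp { ∫ log |b(t)| [1/(z - it) - it/(1+t²)] dt/π }`. -/
def outerPart (b : ℝ → ℂ) (z : ℂ) : ℂ :=
  Complex.exp (∫ t : ℝ, ((Real.log ‖b t‖ / Real.pi : ℝ) : ℂ) *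
    (1 / (z - Complex.I * (t : ℂ)) - Complex.I * (t : ℂ) / (1 + (t : ℂ) ^ 2)))

/-- `V` is outer: it has boundary values a.e., these are a.e. non-zero with `log |V(iy)|`
integrable against `dy/(1+y²)`, and `|V|` equals the modulus of the outer part of `V` throughout
the right half-plane. -/
def IsOuter (V : ℂ → ℂ) : Prop :=
  DifferentiableOn ℂ V rightHalfPlane ∧
  ∃ b : ℝ → ℂ, IsBoundaryValue V b ∧ (∀ᵐ y : ℝ, b y ≠ 0) ∧
    Integrable (fun y : ℝ => Real.log ‖b y‖ / (1 + y ^ 2)) ∧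
    ∀ z ∈ rightHalfPlane, ‖V z‖ = ‖outerPart b z‖

end

/-! At time `t` the set where `|e^{itΔ}ψ|² > e^{-k}` is an explicit ball. Integrating its volume
against `e^{-kw}`, first in `k` (a Gamma integral) and then in `t` (a Beta integral), gives the
closed form `V(z) = (2π)^{d/2} (z + c)^{-(d/2+1)} B(β(z), 1/2)`, with `β(z) = d(z + c - 1)/2 - 1/2`,
for real `z`, and then by analytic continuation for complex `z` (`laplaceTransform_weightFunction`).
Since `c ≥ 1 + 3/(2d)`, the real part of `β` is at least `1/4` on the closed half-plane, so `V` is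
analytic across the imaginary axis. There `B` is bounded and `|V| ≤ C / |z + c|`, which is the Hardy
bound.

Outerness comes from a holomorphic logarithm of slow growth. Expanding `(1 - x)^{-1/2}` gives `B(u,
1/2) = ∑ aₙ / (u + n)` with `aₙ ≥ 0`, so `Re B ≥ 0`; as `B` has no zeros, its principal logarithm is
holomorphic (`betaIntegral_half_mem_slitPlane`). The identity `B(u, 1/2) B(u + 1/2, 1/2) = π / u`
turns the upper bound on `B` into a lower one, so `log V` grows logarithmically. The Poisson formula
(`integral_mul_poissonKernel`) then recovers `log |V|` from its boundary values
(`isOuter_of_eq_exp`). -/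

/-! ### Poisson formula in the half-plane under square-root growth. -/

/-- The kernel of the Herglotz-type integral representation in the right half-plane. -/
noncomputable def herglotzKernel (z : ℂ) (t : ℝ) : ℂ :=
  1 / (z - Complex.I * (t : ℂ)) - Complex.I * (t : ℂ) / (1 + (t : ℂ) ^ 2)

lemma re_le_norm_sub_I_mul (z : ℂ) (t : ℝ) : z.re ≤ ‖z - Complex.I * (t : ℂ)‖ := by
  refine le_trans ?_ (Complex.re_le_norm _)
  simp

lemma sub_I_mul_ne_zero {z : ℂ} (hz : 0 < z.re) (t : ℝ) : z - Complex.I * (t : ℂ) ≠ 0 :=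
  norm_pos_iff.1 (hz.trans_le (re_le_norm_sub_I_mul z t))

lemma one_add_ofReal_sq_ne_zero (t : ℝ) : (1 + (t : ℂ) ^ 2) ≠ 0 := by
  have : (1 + t ^ 2 : ℝ) ≠ 0 := by positivity
  exact_mod_cast this

/-- The subtracted term cancels the `1/t` tail of `1/(z - it)`, leaving quadratic decay. -/
lemma norm_herglotzKernel_le {z : ℂ} (hz : 0 < z.re) (t : ℝ) :
    ‖herglotzKernel z t‖ ≤ (‖1 - z ^ 2‖ / z.re + ‖z‖) / (1 + t ^ 2) := by
  have h1 := sub_I_mul_ne_zero hz t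
  have h2 := one_add_ofReal_sq_ne_zero t
  have h3 : herglotzKernel z t =
      ((1 - z ^ 2) / (z - Complex.I * t) + z) / (1 + (t : ℂ) ^ 2) := by
    unfold herglotzKernel
    field_simp
    ring_nf
    simp only [Complex.I_sq]
    ring
  have h4 : ‖(1 + (t : ℂ) ^ 2)‖ = 1 + t ^ 2 := by
    have : (1 + (t : ℂ) ^ 2) = ((1 + t ^ 2 : ℝ) : ℂ) := by push_cast; rfl
    rw [this, Complex.norm_real, Real.norm_of_nonneg (by positivity)]
  rw [h3, norm_div, h4]
  gcongr
  refine (norm_add_le _ _).trans ?_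
  rw [norm_div]
  gcongr
  exact re_le_norm_sub_I_mul z t

/-- The subtracted term is purely imaginary, so only the Poisson kernel survives. -/
lemma re_herglotzKernel (z : ℂ) (t : ℝ) :
    (herglotzKernel z t).re = z.re / (z.re ^ 2 + (t - z.im) ^ 2) := by
  have h : Complex.I * (t : ℂ) / (1 + (t : ℂ) ^ 2) = ((t / (1 + t ^ 2) : ℝ) : ℂ) * Complex.I := by
    push_cast; ring
  rw [herglotzKernel, h, Complex.sub_re, Complex.re_ofReal_mul, Complex.I_re, mul_zero, sub_zero,
    one_div, Complex.inv_re, Complex.normSq_apply]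
  simp only [Complex.sub_re, Complex.mul_re, Complex.I_re, Complex.ofReal_re, Complex.I_im,
    Complex.ofReal_im, Complex.sub_im, Complex.mul_im]
  ring

lemma continuous_herglotzKernel {z : ℂ} (hz : 0 < z.re) : Continuous (herglotzKernel z) := by
  unfold herglotzKernel
  have h1 := sub_I_mul_ne_zero hz
  have h2 := one_add_ofReal_sq_ne_zero
  fun_prop (disch := simp_all)

lemma integrable_sqrt_div_one_add_sq :
    Integrable (fun t : ℝ => √(1 + |t|) / (1 + t ^ 2)) := by
  have h := (integrable_one_add_norm (E := ℝ) (μ := volume) (r := 3 / 2)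
    (by norm_num [Module.finrank_self])).const_mul 2
  refine h.mono' (Measurable.aestronglyMeasurable (by fun_prop)) (Eventually.of_forall fun t => ?_)
  have h0 : 0 < 1 + |t| := by positivity
  rw [Real.norm_of_nonneg (by positivity), Real.norm_eq_abs, div_le_iff₀ (by positivity),
    Real.sqrt_eq_rpow]
  have h2 : (1 + |t|) ^ (1 / 2 : ℝ) = (1 + |t|) ^ (-(3 / 2) : ℝ) * (1 + |t|) ^ 2 := by
    rw [← Real.rpow_natCast, ← Real.rpow_add h0]; norm_num
  rw [h2]
  have h3 : (1 + |t|) ^ 2 ≤ 2 * (1 + t ^ 2) := by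
    rw [← sq_abs t]; nlinarith [sq_nonneg (1 - |t|)]
  have h4 : 0 < (1 + |t|) ^ (-(3 / 2) : ℝ) := by positivity
  nlinarith

/-- A function of growth at most `√(1 + |t|)` is integrable against a kernel of order
`1 / (1 + t²)`. -/
lemma integrable_mul_of_sqrt_growth {g k : ℝ → ℂ} (hg : Continuous g) (hk : Continuous k)
    {K L : ℝ} (hgK : ∀ t, ‖g t‖ ≤ K * √(1 + |t|)) (hkL : ∀ t, ‖k t‖ ≤ L / (1 + t ^ 2)) :
    Integrable (fun t => g t * k t) := by
  refine (integrable_sqrt_div_one_add_sq.const_mul (K * L)).mono' (by fun_prop)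
    (Eventually.of_forall fun t => ?_)
  rw [norm_mul]
  calc ‖g t‖ * ‖k t‖ ≤ (K * √(1 + |t|)) * (L / (1 + t ^ 2)) :=
        mul_le_mul (hgK t) (hkL t) (norm_nonneg _) ((norm_nonneg _).trans (hgK t))
    _ = _ := by ring

lemma integral_poissonKernel {x : ℝ} (hx : 0 < x) (y : ℝ) :
    ∫ t : ℝ, x / (x ^ 2 + (t - y) ^ 2) = Real.pi := by
  have h : ∫ t : ℝ, Real.pi⁻¹ * x * ((t - y) ^ 2 + x ^ 2)⁻¹ = 1 :=
    ProbabilityTheory.integral_cauchyPDFReal_eq_one y (γ := ⟨x, hx.le⟩)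
      (fun h0 => hx.ne' (congrArg NNReal.toReal h0))
  simp only [mul_assoc, integral_const_mul] at h
  rw [inv_mul_eq_one₀ Real.pi_ne_zero] at h
  rw [h, ← integral_const_mul]
  congr 1; ext t
  rw [div_eq_mul_inv, add_comm]

/-- Far from the origin, the difference quotient of `f` divided by `w + conj z` is small. -/
lemma norm_dslope_div_le {f : ℂ → ℂ} {K : ℝ} {z w : ℂ} {R : ℝ}
    (hf : ‖f w‖ ≤ K * √(1 + ‖w‖)) (hR1 : 1 ≤ R) (hR : 2 * ‖z‖ < R) (hw : R ≤ ‖w‖)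
    (hw' : ‖w‖ ≤ 2 * R) (hK : 0 ≤ K) :
    ‖dslope f z w / (w + (starRingEnd ℂ) z)‖ ≤ (8 * K + 4 * ‖f z‖) * (√R / R ^ 2) := by
  have hne : w ≠ z := by
    rintro rfl; linarith [norm_nonneg w]
  have h1 : R / 2 ≤ ‖w - z‖ := by
    have := norm_sub_norm_le w z; linarith
  have h2 : R / 2 ≤ ‖w + (starRingEnd ℂ) z‖ := by
    have := norm_sub_norm_le w (-(starRingEnd ℂ) z)
    rw [norm_neg, RCLike.norm_conj, sub_neg_eq_add] at this
    linarith
  have hs : 1 ≤ √R := Real.one_le_sqrt.2 hR1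
  have h3 : √(1 + ‖w‖) ≤ 2 * √R := by
    rw [Real.sqrt_le_left (by positivity), mul_pow, Real.sq_sqrt (by linarith)]
    linarith
  have h4 : ‖f w - f z‖ ≤ (2 * K + ‖f z‖) * √R := by
    refine (norm_sub_le _ _).trans ?_
    have : K * √(1 + ‖w‖) ≤ K * (2 * √R) := by gcongr
    nlinarith [norm_nonneg (f z)]
  rw [dslope_of_ne _ hne, slope_def_field, norm_div, norm_div, div_div]
  have hR2 : (R / 2) * (R / 2) ≤ ‖w - z‖ * ‖w + (starRingEnd ℂ) z‖ := by gcongr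
  calc _ ≤ (2 * K + ‖f z‖) * √R / ((R / 2) * (R / 2)) := by gcongr
    _ = _ := by field_simp; ring

/-- **Poisson formula** in the right half-plane for a holomorphic function of growth at most
`√(1 + ‖w‖)`. -/
theorem integral_mul_poissonKernel {f : ℂ → ℂ} {K : ℝ}
    (hf : ∀ w : ℂ, 0 ≤ w.re → DifferentiableAt ℂ f w)
    (hK : ∀ w : ℂ, 0 ≤ w.re → ‖f w‖ ≤ K * √(1 + ‖w‖)) {z : ℂ} (hz : 0 < z.re) :
    ∫ t : ℝ, f (t * Complex.I) * ((herglotzKernel z t).re : ℂ) = Real.pi * f z := by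
  have hK0 : 0 ≤ K := by
    have := (norm_nonneg _).trans (hK 0 le_rfl)
    simpa using this
  -- On the imaginary axis `(w - z)(w + conj z)` is minus the Poisson denominator. Using `dslope`
  -- removes the pole at `z`, and the pole at `-conj z` lies in the left half-plane, so Cauchy's
  -- theorem gives a zero integral.
  set h : ℂ → ℂ := fun w => dslope f z w / (w + (starRingEnd ℂ) z) with hh
  have hne : ∀ w : ℂ, 0 ≤ w.re → w + (starRingEnd ℂ) z ≠ 0 := by
    intro w hw h0
    have := congrArg Complex.re h0
    simp at this
    linarith
  have hd : ∀ w : ℂ, 0 ≤ w.re → DifferentiableAt ℂ h w := by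
    intro w hw
    refine DifferentiableAt.div ?_ (by fun_prop) (hne w hw)
    rcases eq_or_ne w z with rfl | hwz
    · have hs : {w : ℂ | 0 < w.re} ∈ 𝓝 w :=
        (isOpen_lt continuous_const Complex.continuous_re).mem_nhds hz
      exact ((Complex.differentiableOn_dslope hs).2
        (fun u hu => (hf u (le_of_lt hu)).differentiableWithinAt)).differentiableAt hs
    · exact (differentiableAt_dslope_of_ne hwz).2 (hf w hw)
  have hcf : Continuous fun t : ℝ => f (t * Complex.I) := by
    refine continuous_iff_continuousAt.2 fun t => ?_
    exact ContinuousAt.comp (f := fun t : ℝ => (t : ℂ) * Complex.I)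
      (hf _ (by simp)).continuousAt (by fun_prop)
  have hker : Continuous fun t : ℝ => ((herglotzKernel z t).re : ℂ) :=
    Complex.continuous_ofReal.comp (Complex.continuous_re.comp (continuous_herglotzKernel hz))
  have hkerb : ∀ t : ℝ, ‖((herglotzKernel z t).re : ℂ)‖ ≤
      (‖1 - z ^ 2‖ / z.re + ‖z‖) / (1 + t ^ 2) := fun t => by
    rw [Complex.norm_real]
    exact (Complex.abs_re_le_norm _).trans (norm_herglotzKernel_le hz t)
  have hint1 : Integrable fun t : ℝ => f (t * Complex.I) * ((herglotzKernel z t).re : ℂ) :=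
    integrable_mul_of_sqrt_growth hcf hker (K := K)
      (fun t => by simpa using hK (t * Complex.I) (by simp)) hkerb
  have hint2 : Integrable fun t : ℝ => f z * ((herglotzKernel z t).re : ℂ) :=
    integrable_mul_of_sqrt_growth continuous_const hker (K := ‖f z‖)
      (fun t => le_mul_of_one_le_right (norm_nonneg _)
        (Real.one_le_sqrt.2 (by linarith [abs_nonneg t]))) hkerb
  have hhI : ∀ t : ℝ, h (t * Complex.I) = -(1 / (z.re : ℂ)) *
      (f (t * Complex.I) * ((herglotzKernel z t).re : ℂ) -
        f z * ((herglotzKernel z t).re : ℂ)) := by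
    intro t
    have hwz : (t : ℂ) * Complex.I ≠ z := by
      intro h0
      have := congrArg Complex.re h0
      simp at this
      linarith
    have e : ((t : ℂ) * Complex.I - z) * (t * Complex.I + (starRingEnd ℂ) z) =
        -((z.re ^ 2 + (t - z.im) ^ 2 : ℝ) : ℂ) := by
      apply Complex.ext
      · rw [← Complex.ofReal_neg, Complex.ofReal_re]; simp; ring
      · rw [← Complex.ofReal_neg, Complex.ofReal_im]; simp; ring
    have hp : ((z.re ^ 2 + (t - z.im) ^ 2 : ℝ) : ℂ) ≠ 0 := by
      have : (0 : ℝ) < z.re ^ 2 + (t - z.im) ^ 2 := by positivity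
      exact_mod_cast this.ne'
    have hzr : (z.re : ℂ) ≠ 0 := by exact_mod_cast hz.ne'
    simp only [hh]
    rw [dslope_of_ne _ hwz, slope_def_field, div_div, e, re_herglotzKernel, Complex.ofReal_div]
    field_simp
  have hint : Integrable fun t : ℝ => h (t * Complex.I) := by
    simp_rw [hhI]
    exact (hint1.sub hint2).const_mul _
  have hlim := intervalIntegral_tendsto_integral hint tendsto_neg_atTop_atBot tendsto_id
  set M := (8 * K + 4 * ‖f z‖)
  have hM0 : 0 ≤ M := by positivity
  -- Cauchy on `[0, R] × [-R, R]`: the other three sides have total length `4R`, and `‖h‖ ≤ M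
  -- R^{-3/2}` on them.
  have hbound : ∀ᶠ R : ℝ in atTop, ‖∫ t in (-R)..R, h (t * Complex.I)‖ ≤ 4 * M * (√R)⁻¹ := by
    filter_upwards [eventually_ge_atTop 1, eventually_gt_atTop (2 * ‖z‖)] with R hR1 hRz
    have hrect := Complex.integral_boundary_rect_eq_zero_of_differentiableOn h
      (-(R : ℂ) * Complex.I) (R + R * Complex.I) (by
        intro w hw
        refine (hd w ?_).differentiableWithinAt
        have := hw.1
        simp only [Set.mem_preimage] at this
        simp at this
        rw [Set.uIcc_of_le (by linarith)] at this
        exact this.1)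
    simp only [Complex.mul_re, Complex.mul_im, Complex.neg_re, Complex.neg_im, Complex.add_re,
      Complex.add_im, Complex.ofReal_re, Complex.ofReal_im, Complex.I_re, Complex.I_im, mul_zero,
      mul_one, neg_zero, sub_zero, add_zero, zero_add, Complex.ofReal_zero,
      smul_eq_mul] at hrect
    have hsq : R * (√R / R ^ 2) = (√R)⁻¹ := by
      have : 0 < √R := by positivity
      field_simp
      rw [Real.sq_sqrt (by linarith)]
    have hfar : ∀ w : ℂ, 0 ≤ w.re → R ≤ ‖w‖ → ‖w‖ ≤ 2 * R → ‖h w‖ ≤ M * (√R / R ^ 2) :=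
      fun w hw h1 h2 => norm_dslope_div_le (hK w hw) hR1 hRz h1 h2 hK0
    have hhor : ∀ s : ℝ, |s| = R →
        ‖∫ x in (0 : ℝ)..R, h (x + (s : ℂ) * Complex.I)‖ ≤ M * (√R)⁻¹ := by
      intro s hs
      refine (intervalIntegral.norm_integral_le_of_norm_le_const
        (C := M * (√R / R ^ 2)) fun x hx => ?_).trans ?_
      · rw [Set.uIoc_of_le (by linarith)] at hx
        refine hfar _ (by simpa using hx.1.le) ?_ ?_
        · refine le_trans ?_ (Complex.abs_im_le_norm _)
          simp [hs]
        · refine (norm_add_le _ _).trans ?_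
          simp [hs, abs_of_pos hx.1]; linarith [hx.2]
      · rw [sub_zero, abs_of_pos (by linarith), mul_assoc, mul_comm _ R, hsq]
    have hver : ‖∫ y in (-R)..R, h (R + (y : ℂ) * Complex.I)‖ ≤ 2 * M * (√R)⁻¹ := by
      refine (intervalIntegral.norm_integral_le_of_norm_le_const
        (C := M * (√R / R ^ 2)) fun y hy => ?_).trans ?_
      · rw [Set.uIoc_of_le (by linarith)] at hy
        refine hfar _ (by simp; linarith) ?_ ?_
        · refine le_trans ?_ (Complex.re_le_norm _)
          simp
        · refine (norm_add_le _ _).trans ?_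
          have : |y| ≤ R := abs_le.2 ⟨hy.1.le, hy.2⟩
          simp [abs_of_pos (show (0 : ℝ) < R by linarith)]; linarith
      · rw [sub_neg_eq_add, abs_of_pos (by linarith), ← hsq]
        exact le_of_eq (by ring)
    have h1 := hhor R (abs_of_pos (by linarith))
    have h2 := hhor (-R) (by rw [abs_neg]; exact abs_of_pos (by linarith))
    have hI : ‖∫ t in (-R)..R, h (t * Complex.I)‖ =
        ‖(∫ x in (0 : ℝ)..R, h (x + ((-R : ℝ) : ℂ) * Complex.I)) -
          (∫ x in (0 : ℝ)..R, h (x + (R : ℂ) * Complex.I)) +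
          Complex.I * ∫ y in (-R)..R, h (R + (y : ℂ) * Complex.I)‖ := by
      rw [sub_eq_zero.1 hrect, norm_mul, Complex.norm_I, one_mul]
    rw [hI]
    refine (norm_add_le _ _).trans ?_
    rw [norm_mul, Complex.norm_I, one_mul]
    have := norm_sub_le (∫ x in (0 : ℝ)..R, h (x + ((-R : ℝ) : ℂ) * Complex.I))
      (∫ x in (0 : ℝ)..R, h (x + (R : ℂ) * Complex.I))
    linarith
  have hz0 : Tendsto (fun R : ℝ => 4 * M * (√R)⁻¹) atTop (𝓝 0) := by
    simpa using (tendsto_inv_atTop_zero.comp Real.tendsto_sqrt_atTop).const_mul (4 * M)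
  have hzero : ∫ t : ℝ, h (t * Complex.I) = 0 :=
    tendsto_nhds_unique hlim (squeeze_zero_norm' hbound hz0)
  simp_rw [hhI] at hzero
  rw [integral_const_mul, integral_sub hint1 hint2, mul_eq_zero, neg_eq_zero] at hzero
  have hzr : (1 / (z.re : ℂ)) ≠ 0 := by simpa using hz.ne'
  rw [sub_eq_zero.1 (hzero.resolve_left hzr), integral_const_mul]
  simp_rw [re_herglotzKernel]
  rw [integral_complex_ofReal, integral_poissonKernel hz, mul_comm]

/-! ### The function `u ↦ B(u, 1/2)`: positivity, zeros and growth. -/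

lemma Ring.choose_half_nonneg (n : ℕ) : 0 ≤ Ring.choose ((1 / 2 : ℝ) + n - 1) n := by
  have h : Ring.choose ((1 / 2 : ℝ) + n - 1) n = Ring.multichoose (1 / 2 : ℝ) n := by
    rw [Ring.choose]; congr 1; ring
  have h2 := Ring.factorial_nsmul_multichoose_eq_ascPochhammer (1 / 2 : ℝ) n
  rw [Polynomial.ascPochhammer_smeval_eq_eval, nsmul_eq_mul] at h2
  have h3 := ascPochhammer_pos n (1 / 2 : ℝ) (by norm_num)
  rw [← h2] at h3
  rw [h]
  exact (pos_of_mul_pos_right h3 (by positivity)).le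

/-- The binomial series of `(1 - x)^{-1/2}`. -/
lemma hasSum_choose_mul_pow_one_sub_rpow {x : ℝ} (hx0 : 0 < x) (hx1 : x < 1) :
    HasSum (fun n : ℕ => Ring.choose ((1 / 2 : ℝ) + n - 1) n * x ^ n)
      ((1 - x) ^ (-(1 / 2) : ℝ)) := by
  have h := (Real.one_div_one_sub_rpow_hasFPowerSeriesOnBall_zero (1 / 2)).hasSum (y := x)
    (by simpa [enorm_eq_nnnorm, ← NNReal.coe_lt_one, abs_lt] using ⟨by linarith, hx1⟩)
  simp only [zero_add, FormalMultilinearSeries.ofScalars_apply_eq, smul_eq_mul] at h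
  rw [Real.rpow_neg (by linarith), ← one_div]
  exact h

lemma norm_beta_half_integrand {x : ℝ} (hx0 : 0 < x) (hx1 : x < 1) (u : ℂ) :
    ‖(x : ℂ) ^ (u - 1) * (1 - (x : ℂ)) ^ ((1 / 2 : ℂ) - 1)‖ =
      x ^ (u.re - 1) * (1 - x) ^ (-(1 / 2) : ℝ) := by
  have h1 : (1 - (x : ℂ)) = ((1 - x : ℝ) : ℂ) := by push_cast; rfl
  rw [norm_mul, h1, Complex.norm_cpow_eq_rpow_re_of_pos hx0,
    Complex.norm_cpow_eq_rpow_re_of_pos (by linarith)]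
  norm_num

/-- Termwise integration of the binomial series of `(1 - x)^{-1/2}` gives `∑ aₙ / (u + n)` with `aₙ
≥ 0`, and each `1 / (u + n)` has positive real part. -/
lemma re_betaIntegral_half_nonneg {u : ℂ} (hu : 0 < u.re) :
    0 ≤ (Complex.betaIntegral u (1 / 2)).re := by
  set a : ℕ → ℝ := fun n => Ring.choose ((1 / 2 : ℝ) + n - 1) n
  have ha0 : ∀ n, 0 ≤ a n := Ring.choose_half_nonneg
  have hne1 : ∀ᵐ x : ℝ, x ≠ 1 := by simp [ae_iff]
  have hsum : HasSum (fun n : ℕ => ∫ x in (0 : ℝ)..1, (a n : ℂ) * (x : ℂ) ^ (u + n - 1))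
      (Complex.betaIntegral u (1 / 2)) := by
    -- All coefficients being non-negative, the dominating series sums to the norm of the Beta
    -- integrand, which is integrable.
    refine intervalIntegral.hasSum_integral_of_dominated_convergence
      (fun n x => a n * x ^ n * x ^ (u.re - 1)) ?_ ?_ ?_ ?_ ?_
    · intro n
      exact Measurable.aestronglyMeasurable (by fun_prop)
    · intro n
      refine Eventually.of_forall fun x hx => ?_
      rw [Set.uIoc_of_le zero_le_one] at hx
      rw [norm_mul, Complex.norm_real, Real.norm_of_nonneg (ha0 n),
        Complex.norm_cpow_eq_rpow_re_of_pos hx.1, mul_assoc, ← Real.rpow_natCast,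
        ← Real.rpow_add hx.1]
      simp only [Complex.sub_re, Complex.add_re, Complex.natCast_re, Complex.one_re]
      rw [show u.re + n - 1 = n + (u.re - 1) by ring]
    · filter_upwards [hne1] with x hx1 hx
      rw [Set.uIoc_of_le zero_le_one] at hx
      exact ((hasSum_choose_mul_pow_one_sub_rpow hx.1
        (lt_of_le_of_ne hx.2 hx1)).mul_right _).summable
    · have h := (Complex.betaIntegral_convergent hu (v := 1 / 2) (by norm_num)).norm
      refine h.congr_ae ?_
      rw [EventuallyEq, ae_restrict_iff' measurableSet_uIoc]
      filter_upwards [hne1] with x hx1 hx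
      rw [Set.uIoc_of_le zero_le_one] at hx
      have hx1' := lt_of_le_of_ne hx.2 hx1
      rw [norm_beta_half_integrand hx.1 hx1',
        ((hasSum_choose_mul_pow_one_sub_rpow hx.1 hx1').mul_right _).tsum_eq, mul_comm]
    · filter_upwards [hne1] with x hx1 hx
      rw [Set.uIoc_of_le zero_le_one] at hx
      have hx1' := lt_of_le_of_ne hx.2 hx1
      have h := Complex.hasSum_ofReal.2 (hasSum_choose_mul_pow_one_sub_rpow hx.1 hx1')
      have h2 := h.mul_left ((x : ℂ) ^ (u - 1))
      have hx0 : (x : ℂ) ≠ 0 := by exact_mod_cast hx.1.ne'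
      convert h2 using 1
      · rfl
      · funext n
        rw [show u + n - 1 = (u - 1) + n by ring, Complex.cpow_add _ _ hx0, Complex.cpow_natCast,
          Complex.ofReal_mul, Complex.ofReal_pow]
        ring
      · rw [Complex.ofReal_cpow (by linarith)]
        norm_num
  have hre := Complex.reCLM.hasSum hsum
  refine hre.nonneg fun n => ?_
  have hun : 0 < (u + n).re := by
    simp only [Complex.add_re, Complex.natCast_re]; positivity
  have hint : ∫ x in (0 : ℝ)..1, (a n : ℂ) * (x : ℂ) ^ (u + n - 1) = a n * (1 / (u + n)) := by
    rw [intervalIntegral.integral_const_mul, ← Complex.betaIntegral_eval_one_right hun]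
    simp [Complex.betaIntegral]
  simp only [hint, Complex.reCLM_apply, Complex.re_ofReal_mul, one_div,
    Complex.inv_re]
  exact mul_nonneg (ha0 n) (div_nonneg hun.le (Complex.normSq_nonneg _))

lemma betaIntegral_half_eq {u : ℂ} (hu : 0 < u.re) :
    Complex.betaIntegral u (1 / 2) =
      Complex.Gamma u * Complex.Gamma (1 / 2) / Complex.Gamma (u + 1 / 2) := by
  rw [Complex.Gamma_mul_Gamma_eq_betaIntegral hu (by norm_num), mul_div_cancel_left₀]
  exact Complex.Gamma_ne_zero_of_re_pos (by simp; linarith)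

lemma betaIntegral_half_ne_zero {u : ℂ} (hu : 0 < u.re) :
    Complex.betaIntegral u (1 / 2) ≠ 0 := by
  rw [betaIntegral_half_eq hu]
  refine div_ne_zero (mul_ne_zero (Complex.Gamma_ne_zero_of_re_pos hu) ?_) ?_
  · exact Complex.Gamma_ne_zero_of_re_pos (by norm_num)
  · exact Complex.Gamma_ne_zero_of_re_pos (by simp; linarith)

/-- The factors `Γ(u + 1/2)` cancel, leaving `Γ(1/2)² Γ(u) / Γ(u + 1)`. This converts an upper bound
on `B` into a lower bound. -/
lemma betaIntegral_half_mul_add_half {u : ℂ} (hu : 0 < u.re) :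
    Complex.betaIntegral u (1 / 2) * Complex.betaIntegral (u + 1 / 2) (1 / 2) =
      Real.pi / u := by
  have hu2 : 0 < (u + 1 / 2).re := by simp; linarith
  have hu0 : u ≠ 0 := by rintro rfl; simp at hu
  have h1 := Complex.Gamma_ne_zero_of_re_pos hu
  have h2 := Complex.Gamma_ne_zero_of_re_pos hu2
  rw [betaIntegral_half_eq hu, betaIntegral_half_eq hu2, add_assoc, add_halves,
    Complex.Gamma_add_one u hu0]
  have h3 : Complex.Gamma (1 / 2) * Complex.Gamma (1 / 2) = Real.pi := by
    rw [Complex.Gamma_one_half_eq, ← Complex.cpow_add _ _ (by exact_mod_cast Real.pi_ne_zero)]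
    norm_num
  rw [← h3, div_mul_div_comm, div_eq_div_iff (mul_ne_zero h2 (mul_ne_zero hu0 h1)) hu0]
  ring

lemma differentiableAt_betaIntegral_half {u : ℂ} (hu : 0 < u.re) :
    DifferentiableAt ℂ (fun u => Complex.betaIntegral u (1 / 2)) u := by
  have hG : ∀ {s : ℂ}, 0 < s.re → DifferentiableAt ℂ Complex.Gamma s := fun {s} hs => by
    refine Complex.differentiableAt_Gamma s fun m h => ?_
    rw [h] at hs
    simp only [Complex.neg_re, Complex.natCast_re] at hs
    linarith [(Nat.cast_nonneg m : (0 : ℝ) ≤ m)]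
  have hu2 : 0 < (u + 1 / 2).re := by simp; linarith
  have h : DifferentiableAt ℂ (fun u => Complex.Gamma u * Complex.Gamma (1 / 2) /
      Complex.Gamma (u + 1 / 2)) u :=
    ((hG hu).mul_const _).div
      (DifferentiableAt.comp (f := fun u : ℂ => u + 1 / 2) u (hG hu2) (by fun_prop))
      (Complex.Gamma_ne_zero_of_re_pos hu2)
  refine h.congr_of_eventuallyEq ?_
  filter_upwards [(isOpen_lt continuous_const Complex.continuous_re).mem_nhds hu] with s hs
  exact betaIntegral_half_eq hs

/-- For `0 < x < 1` the modulus of the integrand decreases in `Re u`, so the value at `u = a`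
dominates. -/
lemma exists_norm_betaIntegral_half_le {a : ℝ} (ha : 0 < a) :
    ∃ M : ℝ, 0 < M ∧ ∀ u : ℂ, a ≤ u.re → ‖Complex.betaIntegral u (1 / 2)‖ ≤ M := by
  have h := (Complex.betaIntegral_convergent (u := (a : ℂ)) (by simpa using ha) (v := 1 / 2)
    (by norm_num)).norm
  set I := ∫ x in (0 : ℝ)..1, ‖(x : ℂ) ^ ((a : ℂ) - 1) * (1 - (x : ℂ)) ^ ((1 / 2 : ℂ) - 1)‖ with hI
  have hI0 : 0 ≤ I := intervalIntegral.integral_nonneg zero_le_one fun _ _ => norm_nonneg _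
  have hne1 : ∀ᵐ x : ℝ, x ≠ 1 := by simp [ae_iff]
  refine ⟨I + 1, by positivity, fun u hu => ?_⟩
  refine (intervalIntegral.norm_integral_le_of_norm_le zero_le_one ?_ h).trans (by linarith)
  filter_upwards [hne1] with x hx1 hx
  have hx1' := lt_of_le_of_ne hx.2 hx1
  rw [norm_beta_half_integrand hx.1 hx1', norm_beta_half_integrand hx.1 hx1', Complex.ofReal_re]
  refine mul_le_mul_of_nonneg_right ?_ (Real.rpow_nonneg (by linarith) _)
  exact Real.rpow_le_rpow_of_exponent_ge hx.1 hx.2 (by linarith)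

/-- A non-negative real part leaves only the origin to exclude. -/
lemma betaIntegral_half_mem_slitPlane {u : ℂ} (hu : 0 < u.re) :
    Complex.betaIntegral u (1 / 2) ∈ Complex.slitPlane := by
  rw [Complex.mem_slitPlane_iff]
  by_contra! h
  exact betaIntegral_half_ne_zero hu
    (Complex.ext (le_antisymm h.1 (re_betaIntegral_half_nonneg hu)) h.2)

/-- The principal logarithm of `B(u, 1/2)` grows at most logarithmically. -/
lemma exists_norm_log_betaIntegral_half_le {a : ℝ} (ha : 0 < a) :
    ∃ M : ℝ, ∀ u : ℂ, a ≤ u.re →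
      ‖Complex.log (Complex.betaIntegral u (1 / 2))‖ ≤ M + |Real.log ‖u‖| := by
  obtain ⟨M, hM0, hM⟩ := exists_norm_betaIntegral_half_le ha
  refine ⟨2 * |Real.log M| + |Real.log Real.pi| + Real.pi, fun u hu => ?_⟩
  have hu0 : 0 < u.re := ha.trans_le hu
  have hu2 : a ≤ (u + 1 / 2).re := by simp; linarith
  have hun : 0 < ‖u‖ := hu0.trans_le (Complex.re_le_norm u)
  have hB : 0 < ‖Complex.betaIntegral u (1 / 2)‖ := norm_pos_iff.2 (betaIntegral_half_ne_zero hu0)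
  have h1 : Real.log ‖Complex.betaIntegral u (1 / 2)‖ ≤ Real.log M := Real.log_le_log hB (hM u hu)
  -- The upper bound at `u + 1/2`, fed into the product identity, bounds `B(u, 1/2)` from below.
  have h2 : Real.log Real.pi - Real.log ‖u‖ - Real.log M ≤
      Real.log ‖Complex.betaIntegral u (1 / 2)‖ := by
    have hB2 : 0 < ‖Complex.betaIntegral (u + 1 / 2) (1 / 2)‖ :=
      norm_pos_iff.2 (betaIntegral_half_ne_zero (ha.trans_le hu2))
    have h := congrArg (fun w : ℂ => Real.log ‖w‖) (betaIntegral_half_mul_add_half hu0)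
    simp only [norm_mul, norm_div, Complex.norm_real, Real.norm_of_nonneg Real.pi_pos.le] at h
    rw [Real.log_mul hB.ne' hB2.ne', Real.log_div Real.pi_ne_zero hun.ne'] at h
    have := Real.log_le_log hB2 (hM _ hu2)
    linarith
  refine (Complex.norm_le_abs_re_add_abs_im _).trans ?_
  rw [Complex.log_re, Complex.log_im]
  have h3 : |Real.log ‖Complex.betaIntegral u (1 / 2)‖| ≤
      2 * |Real.log M| + |Real.log Real.pi| + |Real.log ‖u‖| := by
    rw [abs_le]
    constructor
    · linarith [neg_abs_le (Real.log Real.pi), le_abs_self (Real.log ‖u‖),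
        le_abs_self (Real.log M), abs_nonneg (Real.log M)]
    · linarith [abs_nonneg (Real.log Real.pi), abs_nonneg (Real.log ‖u‖),
        le_abs_self (Real.log M), abs_nonneg (Real.log M)]
  linarith [Complex.abs_arg_le_pi (Complex.betaIntegral u (1 / 2))]

/-! ### The time integral as a Beta value. -/

lemma integrable_one_add_sq_rpow_neg {β : ℝ} (hβ : 1 / 2 < β) :
    Integrable (fun t : ℝ => (1 + t ^ 2) ^ (-β)) := by
  have h := integrable_rpow_neg_one_add_norm_sq (E := ℝ) (μ := volume) (r := 2 * β)
    (by simp; linarith)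
  convert h using 2 with t
  rw [Real.norm_eq_abs, sq_abs]
  congr 1; ring

lemma image_inv_one_add_sq_Ioi : (fun t : ℝ => (1 + t ^ 2)⁻¹) '' Set.Ioi 0 = Set.Ioo 0 1 := by
  ext u
  constructor
  · rintro ⟨t, ht, rfl⟩
    have : 0 < t ^ 2 := pow_pos ht 2
    exact ⟨by positivity, inv_lt_one_of_one_lt₀ (by linarith)⟩
  · rintro ⟨h0, h1⟩
    have h2 : 0 < u⁻¹ - 1 := by
      have := one_lt_inv_iff₀.2 ⟨h0, h1⟩
      linarith
    refine ⟨√(u⁻¹ - 1), Real.sqrt_pos.2 h2, ?_⟩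
    simp only [Real.sq_sqrt h2.le]
    simp

/-- `∫ (1 + t²)^{-β} dt = B(β - 1/2, 1/2)`. -/
lemma integral_one_add_sq_rpow_neg (β : ℝ) :
    ((∫ t : ℝ, (1 + t ^ 2) ^ (-β) : ℝ) : ℂ) = Complex.betaIntegral (β - 1 / 2) (1 / 2) := by
  have hd : ∀ t ∈ Set.Ioi (0 : ℝ), HasDerivWithinAt (fun t : ℝ => (1 + t ^ 2)⁻¹)
      (-(2 * t) / (1 + t ^ 2) ^ 2) (Set.Ioi 0) t := by
    intro t _
    have h : HasDerivAt (fun t : ℝ => 1 + t ^ 2) (2 * t) t := by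
      simpa using (hasDerivAt_pow 2 t).const_add 1
    exact (h.inv (by positivity)).hasDerivWithinAt
  have hinj : Set.InjOn (fun t : ℝ => (1 + t ^ 2)⁻¹) (Set.Ioi 0) := by
    intro s hs t ht hst
    have h := inv_injective hst
    exact (pow_left_inj₀ (le_of_lt hs) (le_of_lt ht) two_ne_zero).1 (by linarith)
  -- Substitution `u = (1 + t²)⁻¹` on `t > 0`; the half-line `t < 0` contributes equally, by
  -- evenness.
  rw [Complex.betaIntegral, intervalIntegral.integral_of_le zero_le_one,
    integral_Ioc_eq_integral_Ioo, ← image_inv_one_add_sq_Ioi,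
    integral_image_eq_integral_abs_deriv_smul measurableSet_Ioi hd hinj]
  have habs : ∫ t : ℝ, (1 + t ^ 2) ^ (-β) = 2 * ∫ t in Set.Ioi (0 : ℝ), (1 + t ^ 2) ^ (-β) := by
    rw [← integral_comp_abs (f := fun t : ℝ => (1 + t ^ 2) ^ (-β))]
    simp
  rw [habs, ← integral_const_mul, ← integral_complex_ofReal]
  refine setIntegral_congr_fun measurableSet_Ioi fun t ht => ?_
  have ht0 : (0 : ℝ) < t := ht
  have hp : 0 < 1 + t ^ 2 := by positivity
  have h1 : (1 : ℂ) - (((1 + t ^ 2)⁻¹ : ℝ) : ℂ) = ((t ^ 2 / (1 + t ^ 2) : ℝ) : ℂ) := by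
    rw [← Complex.ofReal_one, ← Complex.ofReal_sub]
    congr 1; field_simp; ring
  have h2 : (β : ℂ) - 1 / 2 - 1 = ((β - 3 / 2 : ℝ) : ℂ) := by push_cast; ring
  have h3 : (1 / 2 : ℂ) - 1 = ((-(1 / 2) : ℝ) : ℂ) := by push_cast; ring
  simp only [h1, h2, h3]
  rw [← Complex.ofReal_cpow (by positivity), ← Complex.ofReal_cpow (by positivity),
    ← Complex.ofReal_mul, Complex.real_smul, ← Complex.ofReal_mul]
  congr 1
  rw [neg_div, abs_neg, abs_of_pos (by positivity), Real.div_rpow (by positivity) hp.le,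
    Real.inv_rpow hp.le, ← Real.rpow_neg hp.le]
  have e1 : (t ^ 2) ^ (-(1 / 2) : ℝ) = t⁻¹ := by
    rw [← Real.rpow_natCast t 2, ← Real.rpow_mul ht0.le, ← Real.rpow_neg_one]; norm_num
  rw [e1]
  have e2 : (1 + t ^ 2) ^ (-β) =
      (1 + t ^ 2) ^ (-(β - 3 / 2)) / ((1 + t ^ 2) ^ (-(1 / 2) : ℝ) * (1 + t ^ 2) ^ 2) := by
    rw [← Real.rpow_natCast (1 + t ^ 2) 2, ← Real.rpow_add hp, ← Real.rpow_sub hp]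
    congr 1; norm_num
  rw [e2]
  field_simp

/-! ### Evolution of the Gaussian and its distribution function. -/

lemma fourier_gaussianData {d : ℕ} (ξ : EuclideanSpace ℝ (Fin d)) :
    𝓕 (gaussianData d) ξ = (Real.pi / (1 / 4 : ℂ)) ^ (d / 2 : ℂ) *
      Complex.exp (-Real.pi ^ 2 * ‖ξ‖ ^ 2 / (1 / 4 : ℂ)) := by
  have h : gaussianData d = fun v => Complex.exp (-(1 / 4 : ℂ) * ‖v‖ ^ 2) := by
    ext v
    rw [gaussianData, Complex.ofReal_exp]
    congr 1
    push_cast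
    ring
  rw [h, fourier_gaussian_innerProductSpace (by norm_num), finrank_euclideanSpace, Fintype.card_fin]

/-- Explicit form of the free evolution of the Gaussian. -/
lemma schrodingerPropagator_gaussianData {d : ℕ} (t : ℝ) (x : EuclideanSpace ℝ (Fin d)) :
    schrodingerPropagator t (gaussianData d) x =
      (Real.pi / (1 / 4 : ℂ)) ^ (d / 2 : ℂ) *
        ((Real.pi / (4 * Real.pi ^ 2 * (1 + t * Complex.I))) ^ (d / 2 : ℂ) *
          Complex.exp (-Real.pi ^ 2 * ‖x‖ ^ 2 / (4 * Real.pi ^ 2 * (1 + t * Complex.I)))) := by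
  have hb : 0 < (4 * (Real.pi : ℂ) ^ 2 * (1 + t * Complex.I)).re := by
    have : 4 * (Real.pi : ℂ) ^ 2 = ((4 * Real.pi ^ 2 : ℝ) : ℂ) := by push_cast; rfl
    rw [this, Complex.re_ofReal_mul]
    simp [Real.pi_pos]
  have h : (fun ξ : EuclideanSpace ℝ (Fin d) =>
      Complex.exp (-(4 * (Real.pi : ℂ) ^ 2 * Complex.I * (t : ℂ) * ((‖ξ‖ ^ 2 : ℝ) : ℂ))) *
        𝓕 (gaussianData d) ξ) = fun ξ => (Real.pi / (1 / 4 : ℂ)) ^ (d / 2 : ℂ) *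
      Complex.exp (-(4 * (Real.pi : ℂ) ^ 2 * (1 + t * Complex.I)) * ‖ξ‖ ^ 2) := by
    ext ξ
    rw [fourier_gaussianData, mul_left_comm, ← Complex.exp_add]
    congr 2
    push_cast
    ring
  have hg := fourier_gaussian_innerProductSpace hb (-x)
  rw [norm_neg, finrank_euclideanSpace, Fintype.card_fin] at hg
  rw [schrodingerPropagator, h, ← hg, Real.fourierInv_eq_fourier_neg, Real.fourier_eq,
    Real.fourier_eq, ← integral_const_mul]
  simp_rw [Circle.smul_def, smul_eq_mul, mul_left_comm]

lemma norm_schrodingerPropagator_gaussianData_sq {d : ℕ} (t : ℝ) (x : EuclideanSpace ℝ (Fin d)) :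
    ‖schrodingerPropagator t (gaussianData d) x‖ ^ 2 =
      (1 + t ^ 2) ^ (-(d / 2 : ℝ)) * Real.exp (-(‖x‖ ^ 2 / (2 * (1 + t ^ 2)))) := by
  have hp := Real.pi_pos
  have hn : ‖(1 + t * Complex.I : ℂ)‖ ^ 2 = 1 + t ^ 2 := by
    rw [← Complex.normSq_eq_norm_sq, Complex.normSq_apply]; simp; ring
  have hn0 : 0 < ‖(1 + t * Complex.I : ℂ)‖ := by
    refine lt_of_le_of_ne (norm_nonneg _) fun h0 => ?_
    rw [← h0] at hn
    nlinarith [sq_nonneg t]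
  have hne : (1 + t * Complex.I : ℂ) ≠ 0 := norm_pos_iff.1 hn0
  have hpc : (Real.pi : ℂ) ≠ 0 := by exact_mod_cast hp.ne'
  have hcpow : ∀ w : ℂ, ‖w ^ (d / 2 : ℂ)‖ = ‖w‖ ^ (d / 2 : ℝ) := by
    intro w
    have : (d / 2 : ℂ) = ((d / 2 : ℝ) : ℂ) := by push_cast; rfl
    rw [this, Complex.norm_cpow_real]
  have hexp : (-(Real.pi : ℂ) ^ 2 * ‖x‖ ^ 2 / (4 * Real.pi ^ 2 * (1 + t * Complex.I))).re =
      -(‖x‖ ^ 2 / (4 * (1 + t ^ 2))) := by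
    have : -(Real.pi : ℂ) ^ 2 * ‖x‖ ^ 2 / (4 * Real.pi ^ 2 * (1 + t * Complex.I)) =
        ((-(‖x‖ ^ 2 / 4) : ℝ) : ℂ) * (1 + t * Complex.I)⁻¹ := by
      push_cast; field_simp
    rw [this, Complex.re_ofReal_mul, Complex.inv_re, Complex.normSq_eq_norm_sq, hn]
    simp
    field_simp
  rw [schrodingerPropagator_gaussianData, norm_mul, norm_mul, hcpow,
    hcpow, Complex.norm_exp, hexp, ← mul_assoc,
    ← Real.mul_rpow (norm_nonneg _) (norm_nonneg _), ← norm_mul, mul_pow, ← Real.exp_nat_mul]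
  congr 1
  · have e : (Real.pi : ℂ) / (1 / 4) * (Real.pi / (4 * Real.pi ^ 2 * (1 + t * Complex.I))) =
        (1 + t * Complex.I)⁻¹ := by
      field_simp
    rw [e, norm_inv, ← Real.rpow_natCast, ← Real.rpow_mul (by positivity), mul_comm (d / 2 : ℝ),
      Real.rpow_mul (by positivity), Real.rpow_natCast, inv_pow, hn,
      Real.inv_rpow (by positivity), Real.rpow_neg (by positivity)]
  · congr 1
    push_cast
    field_simp
    ring

/-- The set where `|e^{itΔ}ψ|² > e^{-k}` is, at each time, a ball. -/
lemma setOf_exp_neg_lt_eq_ball {d : ℕ} (k t : ℝ) :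
    {x : EuclideanSpace ℝ (Fin d) |
      Real.exp (-k) < ‖schrodingerPropagator t (gaussianData d) x‖ ^ 2} =
      Metric.ball 0 √(2 * (1 + t ^ 2) * (k - d / 2 * Real.log (1 + t ^ 2))) := by
  ext x
  have hp : 0 < 1 + t ^ 2 := by positivity
  rw [Set.mem_ofPred_eq, norm_schrodingerPropagator_gaussianData_sq, mem_ball_zero_iff,
    Real.lt_sqrt (norm_nonneg _), Real.rpow_def_of_pos hp, ← Real.exp_add, Real.exp_lt_exp,
    mul_comm (2 * (1 + t ^ 2)), ← div_lt_iff₀ (by positivity)]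
  constructor <;> intro h <;> linarith

lemma gaussianDistribution_exp_neg {d : ℕ} (hd : 1 ≤ d) (k : ℝ) :
    gaussianDistribution d (Real.exp (-k)) =
      ∫⁻ t : ℝ, ENNReal.ofReal √(2 * (1 + t ^ 2) * (k - d / 2 * Real.log (1 + t ^ 2))) ^ d *
        ENNReal.ofReal (√Real.pi ^ d / Real.Gamma (d / 2 + 1)) := by
  have : Nonempty (Fin d) := ⟨⟨0, hd⟩⟩
  have hmeas : MeasurableSet {p : ℝ × EuclideanSpace ℝ (Fin d) |
      Real.exp (-k) < ‖schrodingerPropagator p.1 (gaussianData d) p.2‖ ^ 2} := by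
    simp_rw [norm_schrodingerPropagator_gaussianData_sq]
    exact measurableSet_lt measurable_const (by fun_prop)
  rw [gaussianDistribution, Measure.volume_eq_prod, Measure.prod_apply hmeas]
  refine lintegral_congr fun t => ?_
  have := EuclideanSpace.volume_ball (ι := Fin d) 0
    √(2 * (1 + t ^ 2) * (k - d / 2 * Real.log (1 + t ^ 2)))
  rw [← setOf_exp_neg_lt_eq_ball, Fintype.card_fin] at this
  exact this

lemma gaussianDistribution_antitone (d : ℕ) : Antitone (gaussianDistribution d) :=
  fun _ _ h => measure_mono fun _ hp => lt_of_le_of_lt h hp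

lemma measurable_gaussianDistribution_exp_neg (d : ℕ) :
    Measurable fun k : ℝ => gaussianDistribution d (Real.exp (-k)) :=
  (gaussianDistribution_antitone d).measurable.comp (by fun_prop)

/-! ### Laplace transform of `k ↦ μ(e^{-k})` on the real axis. -/

lemma lintegral_rpow_mul_exp_neg_mul_Ioi {p w : ℝ} (hp : 0 ≤ p) (hw : 0 < w) :
    ∫⁻ j in Set.Ioi (0 : ℝ), ENNReal.ofReal (j ^ p * Real.exp (-(w * j))) =
      ENNReal.ofReal ((1 / w) ^ (p + 1) * Real.Gamma (p + 1)) := by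
  have h := Real.integral_rpow_mul_exp_neg_mul_Ioi (a := p + 1) (by linarith) hw
  rw [add_sub_cancel_right] at h
  have hpos : 0 < (1 / w) ^ (p + 1) * Real.Gamma (p + 1) :=
    mul_pos (by positivity) (Real.Gamma_pos_of_pos (by linarith))
  -- A non-integrable function would have integral `0` by convention, but the known value is
  -- positive.
  have hint : IntegrableOn (fun j : ℝ => j ^ p * Real.exp (-(w * j))) (Set.Ioi 0) := by
    by_contra hc
    rw [integral_undef hc] at h
    exact hpos.ne h
  rw [← h, ofReal_integral_eq_lintegral_ofReal hint]
  filter_upwards [ae_restrict_mem measurableSet_Ioi] with j hj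
  have : (0 : ℝ) < j := hj
  positivity

lemma sqrt_pow_eq_rpow_half {x : ℝ} (hx : 0 ≤ x) (d : ℕ) : √x ^ d = x ^ (d / 2 : ℝ) := by
  rw [Real.sqrt_eq_rpow, ← Real.rpow_natCast, ← Real.rpow_mul hx]
  congr 1; ring

lemma lintegral_exp_neg_mul_ofReal_sqrt_pow {d : ℕ} (hd : 1 ≤ d) {w : ℝ} (hw : 0 < w) (t : ℝ) :
    ∫⁻ k in Set.Ioi (0 : ℝ), ENNReal.ofReal (Real.exp (-(k * w))) *
      ENNReal.ofReal √(2 * (1 + t ^ 2) * (k - d / 2 * Real.log (1 + t ^ 2))) ^ d =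
    ENNReal.ofReal (2 ^ (d / 2 : ℝ) * (1 + t ^ 2) ^ (-(d / 2 * (w - 1))) *
      ((1 / w) ^ (d / 2 + 1 : ℝ) * Real.Gamma (d / 2 + 1))) := by
  have hp : 0 < 1 + t ^ 2 := by positivity
  set s := d / 2 * Real.log (1 + t ^ 2) with hs
  have hs0 : 0 ≤ s := mul_nonneg (by positivity) (Real.log_nonneg (by nlinarith [sq_nonneg t]))
  have h1 : ∀ k : ℝ, (Set.Ioi (0 : ℝ)).indicator (fun k => ENNReal.ofReal (Real.exp (-(k * w))) *
      ENNReal.ofReal √(2 * (1 + t ^ 2) * (k - s)) ^ d) k =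
      (Set.Ioi s).indicator (fun k => ENNReal.ofReal (Real.exp (-(k * w))) *
      ENNReal.ofReal √(2 * (1 + t ^ 2) * (k - s)) ^ d) k := by
    intro k
    by_cases hk : s < k
    · rw [Set.indicator_of_mem (show k ∈ Set.Ioi s from hk),
        Set.indicator_of_mem (show k ∈ Set.Ioi 0 from hs0.trans_lt hk)]
    · rw [Set.indicator_of_notMem (show k ∉ Set.Ioi s from hk)]
      refine Set.indicator_apply_eq_zero.2 fun _ => ?_
      -- Below the threshold `s` the real square root takes its default value `0`, and `0 ^ d = 0`
      -- because `d ≥ 1`.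
      rw [Real.sqrt_eq_zero_of_nonpos, ENNReal.ofReal_zero, zero_pow (by omega), mul_zero]
      exact mul_nonpos_of_nonneg_of_nonpos (by positivity) (by linarith)
  -- Shifting by `s` extracts `e^{-sw} = (1 + t²)^{-dw/2}`, which merges with the factor `(1 +
  -- t²)^{d/2}` from the radius.
  have h2 : ∀ j : ℝ, (Set.Ioi s).indicator (fun k => ENNReal.ofReal (Real.exp (-(k * w))) *
      ENNReal.ofReal √(2 * (1 + t ^ 2) * (k - s)) ^ d) (j + s) =
      (Set.Ioi (0 : ℝ)).indicator (fun j => ENNReal.ofReal (2 ^ (d / 2 : ℝ) *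
        (1 + t ^ 2) ^ (-(d / 2 * (w - 1)))) *
        ENNReal.ofReal (j ^ (d / 2 : ℝ) * Real.exp (-(w * j)))) j := by
    intro j
    by_cases hj : 0 < j
    · rw [Set.indicator_of_mem (show j ∈ Set.Ioi 0 from hj),
        Set.indicator_of_mem (show j + s ∈ Set.Ioi s by simpa using hj), add_sub_cancel_right,
        ← ENNReal.ofReal_pow (Real.sqrt_nonneg _), ← ENNReal.ofReal_mul (by positivity),
        ← ENNReal.ofReal_mul (by positivity), sqrt_pow_eq_rpow_half (by positivity),
        Real.mul_rpow (by positivity) hj.le, Real.mul_rpow (by positivity) hp.le]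
      congr 1
      have e1 : Real.exp (-((j + s) * w)) =
          Real.exp (-(w * j)) * (1 + t ^ 2) ^ (-(d / 2 * w)) := by
        rw [Real.rpow_def_of_pos hp, ← Real.exp_add, hs]
        congr 1; ring
      have e2 : (1 + t ^ 2) ^ (-(d / 2 * (w - 1))) =
          (1 + t ^ 2) ^ (-(d / 2 * w)) * (1 + t ^ 2) ^ (d / 2 : ℝ) := by
        rw [← Real.rpow_add hp]
        congr 1; ring
      rw [e1, e2]
      ring
    · rw [Set.indicator_of_notMem (show j ∉ Set.Ioi 0 from hj),
        Set.indicator_of_notMem (show j + s ∉ Set.Ioi s by simpa using hj)]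
  rw [← lintegral_indicator measurableSet_Ioi]
  simp_rw [h1]
  rw [← lintegral_add_right_eq_self _ s]
  simp_rw [h2]
  rw [lintegral_indicator measurableSet_Ioi, lintegral_const_mul _ (by fun_prop),
    lintegral_rpow_mul_exp_neg_mul_Ioi (by positivity) hw, ← ENNReal.ofReal_mul (by positivity)]

/-- The Laplace transform of `k ↦ μ(e^{-k})` on the real axis. -/
lemma lintegral_exp_neg_mul_gaussianDistribution {d : ℕ} (hd : 1 ≤ d) {w : ℝ} (hw : 0 < w)
    (hβ : 1 / 2 < d / 2 * (w - 1)) :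
    ∫⁻ k in Set.Ioi (0 : ℝ), ENNReal.ofReal (Real.exp (-(k * w))) *
      gaussianDistribution d (Real.exp (-k)) =
    ENNReal.ofReal ((2 * Real.pi) ^ (d / 2 : ℝ) * w ^ (-(d / 2 + 1) : ℝ) *
      ∫ t : ℝ, (1 + t ^ 2) ^ (-(d / 2 * (w - 1)))) := by
  have hG : 0 < Real.Gamma (d / 2 + 1) := Real.Gamma_pos_of_pos (by positivity)
  simp_rw [gaussianDistribution_exp_neg hd]
  have h1 : ∀ k : ℝ, ENNReal.ofReal (Real.exp (-(k * w))) *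
      (∫⁻ t : ℝ, ENNReal.ofReal √(2 * (1 + t ^ 2) * (k - d / 2 * Real.log (1 + t ^ 2))) ^ d *
        ENNReal.ofReal (√Real.pi ^ d / Real.Gamma (d / 2 + 1))) =
      ∫⁻ t : ℝ, (ENNReal.ofReal (Real.exp (-(k * w))) *
        ENNReal.ofReal √(2 * (1 + t ^ 2) * (k - d / 2 * Real.log (1 + t ^ 2))) ^ d) *
        ENNReal.ofReal (√Real.pi ^ d / Real.Gamma (d / 2 + 1)) := by
    intro k
    rw [← lintegral_const_mul _ (by fun_prop)]
    simp_rw [mul_assoc]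
  simp_rw [h1]
  rw [lintegral_lintegral_swap (by fun_prop)]
  have h2 : ∀ t : ℝ, ∫⁻ k in Set.Ioi (0 : ℝ), (ENNReal.ofReal (Real.exp (-(k * w))) *
        ENNReal.ofReal √(2 * (1 + t ^ 2) * (k - d / 2 * Real.log (1 + t ^ 2))) ^ d) *
        ENNReal.ofReal (√Real.pi ^ d / Real.Gamma (d / 2 + 1)) =
      ENNReal.ofReal (((2 * Real.pi) ^ (d / 2 : ℝ) * w ^ (-(d / 2 + 1) : ℝ)) *
        (1 + t ^ 2) ^ (-(d / 2 * (w - 1)))) := by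
    intro t
    rw [lintegral_mul_const _ (by fun_prop), lintegral_exp_neg_mul_ofReal_sqrt_pow hd hw,
      ← ENNReal.ofReal_mul (by positivity), sqrt_pow_eq_rpow_half Real.pi_pos.le,
      Real.mul_rpow (by norm_num) Real.pi_pos.le, one_div, Real.inv_rpow hw.le,
      ← Real.rpow_neg hw.le]
    congr 1
    field_simp
  simp_rw [h2]
  rw [← integral_const_mul, ofReal_integral_eq_lintegral_ofReal
    ((integrable_one_add_sq_rpow_neg hβ).const_mul _)]
  exact Eventually.of_forall fun t => by positivity

/-- A finite Laplace transform at one point forces `μ(e^{-k})` to be finite for almost every `k >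
0`; monotonicity extends this to every level. The choice `w = 3` makes the exponent `d(w - 1)/2`
equal to `d`. -/
lemma gaussianDistribution_lt_top {d : ℕ} (hd : 1 ≤ d) {lam : ℝ} (hlam : 0 < lam) :
    gaussianDistribution d lam < ⊤ := by
  have hd' : (1 : ℝ) ≤ d := by exact_mod_cast hd
  have h := lintegral_exp_neg_mul_gaussianDistribution hd (w := 3) (by norm_num) (by linarith)
  have hae := ae_lt_top (f := fun k : ℝ => ENNReal.ofReal (Real.exp (-(k * 3))) *
      gaussianDistribution d (Real.exp (-k)))
    ((by fun_prop : Measurable fun k : ℝ => ENNReal.ofReal (Real.exp (-(k * 3)))).mul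
      (measurable_gaussianDistribution_exp_neg d)) (h.trans_ne ENNReal.ofReal_ne_top)
  have hsub : Set.Ioi (max 0 (-Real.log lam)) ⊆ Set.Ioi 0 :=
    Set.Ioi_subset_Ioi (le_max_left _ _)
  have hae' := (ae_restrict_of_ae_restrict_of_subset hsub hae).and
    (ae_restrict_mem measurableSet_Ioi)
  have : NeBot (ae (volume.restrict (Set.Ioi (max 0 (-Real.log lam))))) := by
    rw [ae_neBot, Ne, Measure.restrict_eq_zero]
    simp
  obtain ⟨k, hk, hkm⟩ := hae'.exists
  have hk2 : -Real.log lam < k := (le_max_right _ _).trans_lt hkm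
  refine (gaussianDistribution_antitone d (show Real.exp (-k) ≤ lam from ?_)).trans_lt
    (ENNReal.lt_top_of_mul_ne_top_right hk.ne ?_)
  · rw [← Real.le_log_iff_exp_le hlam]; linarith
  · simp [Real.exp_pos]

/-! ### Closed form of `V` by analytic continuation. -/

lemma measurable_weightFunction (d : ℕ) (c : ℝ) : Measurable (weightFunction d c) :=
  (by fun_prop : Measurable fun k : ℝ => Real.exp (-(c * k))).mul
    (measurable_gaussianDistribution_exp_neg d).ennreal_toReal

lemma weightFunction_nonneg (d : ℕ) (c k : ℝ) : 0 ≤ weightFunction d c k :=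
  mul_nonneg (Real.exp_pos _).le ENNReal.toReal_nonneg

lemma ofReal_exp_mul_weightFunction {d : ℕ} (hd : 1 ≤ d) (c x k : ℝ) :
    ENNReal.ofReal (Real.exp (-(k * x)) * weightFunction d c k) =
      ENNReal.ofReal (Real.exp (-(k * (x + c)))) * gaussianDistribution d (Real.exp (-k)) := by
  rw [weightFunction, ← mul_assoc, ← Real.exp_add, ENNReal.ofReal_mul (Real.exp_pos _).le,
    ENNReal.ofReal_toReal (gaussianDistribution_lt_top hd (Real.exp_pos _)).ne]
  congr 4
  ring

/-- The abscissa `1 + 1/d - c` is where the time integral stops converging, that is, where `Re β(z)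
= 0`. -/
lemma half_lt_of_abscissa_lt {d : ℕ} (hd : 1 ≤ d) {c x : ℝ} (hx : 1 + 1 / (d : ℝ) - c < x) :
    1 / 2 < (d : ℝ) / 2 * (x + c - 1) := by
  have hd0 : (0 : ℝ) < d := by exact_mod_cast hd
  have h : 1 / (d : ℝ) < x + c - 1 := by linarith
  rw [div_lt_iff₀ hd0] at h
  linarith

lemma add_pos_of_abscissa_lt {d : ℕ} {c x : ℝ} (hx : 1 + 1 / (d : ℝ) - c < x) : 0 < x + c := by
  have : (0 : ℝ) ≤ 1 / (d : ℝ) := by positivity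
  linarith

lemma lintegral_exp_mul_weightFunction {d : ℕ} (hd : 1 ≤ d) {c x : ℝ}
    (hx : 1 + 1 / (d : ℝ) - c < x) :
    ∫⁻ k in Set.Ioi (0 : ℝ), ENNReal.ofReal (Real.exp (-(k * x)) * weightFunction d c k) =
      ENNReal.ofReal ((2 * Real.pi) ^ (d / 2 : ℝ) * (x + c) ^ (-(d / 2 + 1) : ℝ) *
        ∫ t : ℝ, (1 + t ^ 2) ^ (-(d / 2 * (x + c - 1)))) := by
  simp_rw [ofReal_exp_mul_weightFunction hd]
  exact lintegral_exp_neg_mul_gaussianDistribution hd (add_pos_of_abscissa_lt hx)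
    (half_lt_of_abscissa_lt hd hx)

lemma integrableOn_exp_mul_weightFunction {d : ℕ} (hd : 1 ≤ d) {c : ℝ} {z : ℂ}
    (hz : 1 + 1 / (d : ℝ) - c < z.re) :
    IntegrableOn (fun k : ℝ => Complex.exp (-((k : ℂ) * z)) * (weightFunction d c k : ℂ))
      (Set.Ioi 0) := by
  have hm := measurable_weightFunction d c
  refine ⟨Measurable.aestronglyMeasurable (by fun_prop), ?_⟩
  have h : ∀ k : ℝ, ‖Complex.exp (-((k : ℂ) * z)) * (weightFunction d c k : ℂ)‖ₑ =
      ENNReal.ofReal (Real.exp (-(k * z.re)) * weightFunction d c k) := by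
    intro k
    rw [← ofReal_norm, norm_mul, Complex.norm_exp, Complex.norm_real,
      Real.norm_of_nonneg (weightFunction_nonneg d c k)]
    simp
  rw [hasFiniteIntegral_iff_enorm]
  simp_rw [h]
  rw [lintegral_exp_mul_weightFunction hd hz]
  exact ENNReal.ofReal_lt_top

/-- The measure on the half-line with density `weightFunction d c`. -/
noncomputable def weightMeasure (d : ℕ) (c : ℝ) : Measure ℝ :=
  (volume.restrict (Set.Ioi 0)).withDensity fun k => ENNReal.ofReal (weightFunction d c k)

/-- Gives holomorphy of `V` from that of complex moment generating functions inside their strip of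
integrability. -/
lemma laplaceTransform_weightFunction_eq_complexMGF (d : ℕ) (c : ℝ) :
    laplaceTransform (weightFunction d c) =
      ProbabilityTheory.complexMGF (fun k : ℝ => -k) (weightMeasure d c) := by
  ext z
  rw [laplaceTransform, ProbabilityTheory.complexMGF, weightMeasure,
    integral_withDensity_eq_integral_toReal_smul
      (measurable_weightFunction d c).ennreal_ofReal (by simp)]
  congr 1; ext k
  rw [ENNReal.toReal_ofReal (weightFunction_nonneg d c k), Complex.real_smul, mul_comm]
  congr 2
  push_cast; ring

lemma mem_integrableExpSet_weightMeasure {d : ℕ} (hd : 1 ≤ d) {c x : ℝ}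
    (hx : 1 + 1 / (d : ℝ) - c < x) :
    x ∈ ProbabilityTheory.integrableExpSet (fun k : ℝ => -k) (weightMeasure d c) := by
  rw [ProbabilityTheory.integrableExpSet, Set.mem_ofPred_eq, weightMeasure,
    integrable_withDensity_iff_integrable_smul' (measurable_weightFunction d c).ennreal_ofReal
      (by simp)]
  have h := (integrableOn_exp_mul_weightFunction hd (z := (x : ℂ)) (by simpa using hx)).norm
  refine h.congr (Eventually.of_forall fun k => ?_)
  simp only [norm_mul, Complex.norm_exp, Complex.norm_real, smul_eq_mul,
    Real.norm_of_nonneg (weightFunction_nonneg d c k),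
    ENNReal.toReal_ofReal (weightFunction_nonneg d c k)]
  rw [mul_comm]
  congr 2
  simp [mul_comm]

lemma differentiableOn_laplaceTransform_weightFunction {d : ℕ} (hd : 1 ≤ d) (c : ℝ) :
    DifferentiableOn ℂ (laplaceTransform (weightFunction d c))
      {z : ℂ | 1 + 1 / (d : ℝ) - c < z.re} := by
  rw [laplaceTransform_weightFunction_eq_complexMGF]
  refine ProbabilityTheory.differentiableOn_complexMGF.mono fun z hz => ?_
  exact mem_interior.2 ⟨Set.Ioi (1 + 1 / (d : ℝ) - c),
    fun x hx => mem_integrableExpSet_weightMeasure hd hx, isOpen_Ioi, hz⟩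

/-- The argument of the Beta function in the closed form of the Laplace transform. -/
noncomputable def betaArgument (d : ℕ) (c : ℝ) (z : ℂ) : ℂ := (d : ℂ) / 2 * (z + c - 1) - 1 / 2

lemma re_betaArgument (d : ℕ) (c : ℝ) (z : ℂ) :
    (betaArgument d c z).re = (d : ℝ) / 2 * (z.re + c - 1) - 1 / 2 := by
  have h : (d : ℂ) / 2 = ((d / 2 : ℝ) : ℂ) := by push_cast; rfl
  rw [betaArgument, h, Complex.sub_re, Complex.re_ofReal_mul]
  simp

lemma differentiable_betaArgument (d : ℕ) (c : ℝ) : Differentiable ℂ (betaArgument d c) := by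
  unfold betaArgument
  fun_prop

lemma laplaceTransform_weightFunction_ofReal {d : ℕ} (hd : 1 ≤ d) {c x : ℝ}
    (hx : 1 + 1 / (d : ℝ) - c < x) :
    laplaceTransform (weightFunction d c) x =
      (((2 * Real.pi) ^ (d / 2 : ℝ) : ℝ) : ℂ) * ((x : ℂ) + c) ^ ((-(d / 2 + 1) : ℝ) : ℂ) *
        Complex.betaIntegral (betaArgument d c x) (1 / 2) := by
  have hxc := add_pos_of_abscissa_lt hx
  have h1 : laplaceTransform (weightFunction d c) x =
      ((∫ k in Set.Ioi (0 : ℝ), Real.exp (-(k * x)) * weightFunction d c k : ℝ) : ℂ) := by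
    rw [laplaceTransform, ← integral_complex_ofReal]
    congr 1; ext k
    push_cast; rfl
  have hm := measurable_weightFunction d c
  have hJ : 0 ≤ ∫ t : ℝ, (1 + t ^ 2) ^ (-((d : ℝ) / 2 * (x + c - 1))) :=
    integral_nonneg fun t => by positivity
  have h2 : betaArgument d c x = (((d : ℝ) / 2 * (x + c - 1) : ℝ) : ℂ) - 1 / 2 := by
    rw [betaArgument]; push_cast; rfl
  rw [h1, integral_eq_lintegral_of_nonneg_ae
    (Eventually.of_forall fun k => mul_nonneg (Real.exp_pos _).le (weightFunction_nonneg d c k))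
    (Measurable.aestronglyMeasurable (by fun_prop)), lintegral_exp_mul_weightFunction hd hx,
    ENNReal.toReal_ofReal (by positivity), h2, ← integral_one_add_sq_rpow_neg,
    ← Complex.ofReal_add, ← Complex.ofReal_cpow hxc.le]
  push_cast
  rfl

/-- Closed form of the Laplace transform, by analytic continuation from the real axis. -/
theorem laplaceTransform_weightFunction {d : ℕ} (hd : 1 ≤ d) {c : ℝ} {z : ℂ}
    (hz : 1 + 1 / (d : ℝ) - c < z.re) :
    laplaceTransform (weightFunction d c) z =
      (((2 * Real.pi) ^ (d / 2 : ℝ) : ℝ) : ℂ) * (z + c) ^ ((-(d / 2 + 1) : ℝ) : ℂ) *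
        Complex.betaIntegral (betaArgument d c z) (1 / 2) := by
  set a := 1 + 1 / (d : ℝ) - c
  have hopen : IsOpen {z : ℂ | a < z.re} := isOpen_lt continuous_const Complex.continuous_re
  have hW : DifferentiableOn ℂ (fun z : ℂ => (((2 * Real.pi) ^ (d / 2 : ℝ) : ℝ) : ℂ) *
      (z + c) ^ ((-(d / 2 + 1) : ℝ) : ℂ) *
        Complex.betaIntegral (betaArgument d c z) (1 / 2)) {z : ℂ | a < z.re} := by
    intro z hz
    have hre : 0 < (betaArgument d c z).re := by
      rw [re_betaArgument]
      have := half_lt_of_abscissa_lt hd hz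
      linarith
    have hzc : z + c ∈ Complex.slitPlane := Or.inl (by simpa using add_pos_of_abscissa_lt hz)
    refine DifferentiableAt.differentiableWithinAt (DifferentiableAt.mul ?_ ?_)
    · exact (((differentiableAt_id (𝕜 := ℂ)).add_const (c : ℂ)).cpow
        (differentiableAt_const _) hzc).const_mul _
    · exact DifferentiableAt.comp (f := betaArgument d c) z
        (differentiableAt_betaIntegral_half hre) (differentiable_betaArgument d c z)
  have hx0 : ((a + 1 : ℝ) : ℂ) ∈ {z : ℂ | a < z.re} := by simp
  refine ((differentiableOn_laplaceTransform_weightFunction hd c).analyticOnNhd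
    hopen).eqOn_of_preconnected_of_frequently_eq (hW.analyticOnNhd hopen)
    (convex_halfSpace_re_gt a).isPreconnected hx0 ?_ hz
  have ht : Tendsto (fun x : ℝ => (x : ℂ)) (𝓝[≠] (a + 1)) (𝓝[≠] ((a + 1 : ℝ) : ℂ)) :=
    Complex.continuous_ofReal.continuousAt.continuousWithinAt.tendsto_nhdsWithin
      fun x hx => by simpa [← Complex.ofReal_inj] using hx
  refine ht.frequently (Eventually.frequently ?_)
  filter_upwards [mem_nhdsWithin_of_mem_nhds (isOpen_Ioi.mem_nhds (lt_add_one a))] with x hx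
  exact laplaceTransform_weightFunction_ofReal hd hx

/-! ### Outerness from a slowly growing logarithm. -/

/-- The exponential of a holomorphic function with growth at most `√(1 + ‖w‖)` up to the
boundary is outer. -/
theorem isOuter_of_eq_exp {V f : ℂ → ℂ} {K : ℝ}
    (hf : ∀ w : ℂ, 0 ≤ w.re → DifferentiableAt ℂ f w)
    (hK : ∀ w : ℂ, 0 ≤ w.re → ‖f w‖ ≤ K * √(1 + ‖w‖))
    (hV : ∀ w : ℂ, 0 ≤ w.re → V w = Complex.exp (f w)) : IsOuter V := by
  have hcf : Continuous fun t : ℝ => f (t * Complex.I) := by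
    refine continuous_iff_continuousAt.2 fun t => ?_
    exact ContinuousAt.comp (f := fun t : ℝ => (t : ℂ) * Complex.I)
      (hf _ (by simp)).continuousAt (by fun_prop)
  have hlog : ∀ t : ℝ, Real.log ‖V (t * Complex.I)‖ = (f (t * Complex.I)).re := fun t => by
    rw [hV _ (by simp), Complex.norm_exp, Real.log_exp]
  have hclog : Continuous fun t : ℝ => ((Real.log ‖V (t * Complex.I)‖ : ℝ) : ℂ) := by
    simp_rw [hlog]
    exact Complex.continuous_ofReal.comp (Complex.continuous_re.comp hcf)
  have hlogK : ∀ t : ℝ, ‖((Real.log ‖V (t * Complex.I)‖ : ℝ) : ℂ)‖ ≤ K * √(1 + |t|) := fun t => by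
    rw [hlog, Complex.norm_real]
    refine (Complex.abs_re_le_norm _).trans ?_
    simpa using hK (t * Complex.I) (by simp)
  refine ⟨?_, fun t => V (t * Complex.I), ?_, ?_, ?_, ?_⟩
  · intro z hz
    refine DifferentiableWithinAt.congr (f := fun w => Complex.exp (f w)) ?_
      (fun w hw => hV w (le_of_lt hw)) (hV z (le_of_lt hz))
    exact (hf z (le_of_lt hz)).cexp.differentiableWithinAt
  · refine Eventually.of_forall fun y => ?_
    have h1 : Tendsto (fun x : ℝ => Complex.exp (f ((x : ℂ) + y * Complex.I))) (𝓝[>] 0)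
        (𝓝 (Complex.exp (f (y * Complex.I)))) := by
      have hc : ContinuousAt (fun w => Complex.exp (f w)) (y * Complex.I) :=
        (hf _ (by simp)).cexp.continuousAt
      refine hc.tendsto.comp (tendsto_nhdsWithin_of_tendsto_nhds ?_)
      have : Continuous fun x : ℝ => (x : ℂ) + y * Complex.I := by fun_prop
      simpa using this.tendsto 0
    rw [← hV _ (by simp)] at h1
    refine h1.congr' ?_
    filter_upwards [self_mem_nhdsWithin] with x hx
    exact (hV _ (by simpa using (show (0 : ℝ) < x from hx).le)).symm
  · exact Eventually.of_forall fun y => (hV (y * Complex.I) (by simp)).trans_ne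
      (Complex.exp_ne_zero _)
  · have h := integrable_mul_of_sqrt_growth (k := fun t : ℝ => ((1 / (1 + t ^ 2) : ℝ) : ℂ)) hclog
      (Complex.continuous_ofReal.comp (by fun_prop (disch := intros; positivity)))
      hlogK (L := 1) (fun t => by
        rw [Complex.norm_real, Real.norm_of_nonneg (by positivity)])
    refine h.re.congr (Eventually.of_forall fun t => ?_)
    simp only [← Complex.ofReal_mul]
    rw [mul_one_div]
    exact Complex.ofReal_re _
  · intro z hz
    have hz' : 0 < z.re := hz
    have hker := continuous_herglotzKernel hz'
    have hkerb := norm_herglotzKernel_le hz'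
    have hint1 : Integrable fun t : ℝ =>
        ((Real.log ‖V (t * Complex.I)‖ / Real.pi : ℝ) : ℂ) * herglotzKernel z t := by
      have := (integrable_mul_of_sqrt_growth hclog hker hlogK hkerb).const_mul
        ((Real.pi⁻¹ : ℝ) : ℂ)
      refine this.congr (Eventually.of_forall fun t => ?_)
      simp only [div_eq_mul_inv, Complex.ofReal_mul]
      ring
    have hint2 : Integrable fun t : ℝ => f (t * Complex.I) * ((herglotzKernel z t).re : ℂ) := by
      refine integrable_mul_of_sqrt_growth hcf (Complex.continuous_ofReal.comp
        (Complex.continuous_re.comp hker)) (K := K)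
        (L := ‖1 - z ^ 2‖ / z.re + ‖z‖)
        (fun t => by simpa using hK (t * Complex.I) (by simp)) (fun t => ?_)
      rw [Complex.norm_real]
      exact (Complex.abs_re_le_norm _).trans (hkerb t)
    -- On the axis `log |V| = Re f`, so the real part of the Poisson formula is the log-modulus of
    -- the outer part, up to the factor `π`.
    have hP := congrArg Complex.re (integral_mul_poissonKernel hf hK hz')
    rw [Complex.re_ofReal_mul, ← Complex.reCLM_apply,
      ← Complex.reCLM.integral_comp_comm hint2] at hP
    have hre : (∫ t : ℝ, ((Real.log ‖V (t * Complex.I)‖ / Real.pi : ℝ) : ℂ) *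
        herglotzKernel z t).re = (f z).re := by
      rw [← Complex.reCLM_apply, ← Complex.reCLM.integral_comp_comm hint1,
        ← mul_right_inj' Real.pi_ne_zero, ← hP, ← integral_const_mul]
      congr 1; ext t
      rw [Complex.reCLM_apply, Complex.reCLM_apply, Complex.re_ofReal_mul, Complex.re_mul_ofReal,
        hlog]
      field_simp
    rw [hV z hz'.le, outerPart, Complex.norm_exp, Complex.norm_exp]
    exact congrArg Real.exp hre.symm

/-! ### Bounds on `V` and `log V` in the closed half-plane, and the conclusion. -/

lemma abs_log_le_of_le {x₀ x : ℝ} (hx₀ : 0 < x₀) (hx : x₀ ≤ x) :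
    |Real.log x| ≤ |Real.log x₀| + 2 * √x := by
  have hx' := hx₀.trans_le hx
  have h1 : Real.log x ≤ 2 * √x := by
    have h := Real.log_le_sub_one_of_pos (Real.sqrt_pos.2 hx')
    rw [Real.log_sqrt hx'.le] at h
    linarith
  have h2 := Real.log_le_log hx₀ hx
  rw [abs_le]
  constructor
  · linarith [neg_abs_le (Real.log x₀), Real.sqrt_nonneg x]
  · linarith [abs_nonneg (Real.log x₀)]

lemma abs_log_norm_le_mul_sqrt {w z : ℂ} {x₀ L : ℝ} (hx₀ : 0 < x₀) (hx : x₀ ≤ ‖w‖)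
    (hL : ‖w‖ ≤ L * (1 + ‖z‖)) :
    |Real.log ‖w‖| ≤ (|Real.log x₀| + 2 * √L) * √(1 + ‖z‖) := by
  have hs : 1 ≤ √(1 + ‖z‖) := Real.one_le_sqrt.2 (by linarith [norm_nonneg z])
  have h1 : √‖w‖ ≤ √L * √(1 + ‖z‖) := by
    rw [← Real.sqrt_mul' _ (by positivity)]
    exact Real.sqrt_le_sqrt hL
  have h2 := abs_log_le_of_le hx₀ hx
  nlinarith [abs_nonneg (Real.log x₀)]

/-- Here `1/4 = (d/2) · 3/(2d) - 1/2`: the bound on `c` keeps the Beta argument uniformly away from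
the pole of `B` at `0`. -/
lemma quarter_le_re_betaArgument {d : ℕ} (hd : 1 ≤ d) {c : ℝ} (hc : 1 + 3 / (2 * (d : ℝ)) ≤ c)
    {z : ℂ} (hz : 0 ≤ z.re) : 1 / 4 ≤ (betaArgument d c z).re := by
  have hd0 : (0 : ℝ) < d := by exact_mod_cast hd
  have h : 3 / (2 * (d : ℝ)) ≤ z.re + c - 1 := by linarith
  rw [div_le_iff₀ (by positivity)] at h
  rw [re_betaArgument]
  linarith

lemma abscissa_neg {d : ℕ} (hd : 1 ≤ d) {c : ℝ} (hc : 1 + 3 / (2 * (d : ℝ)) ≤ c) :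
    1 + 1 / (d : ℝ) - c < 0 := by
  have hd0 : (0 : ℝ) < d := by exact_mod_cast hd
  have h : 3 / (2 * (d : ℝ)) = 1 / d + 1 / (2 * d) := by field_simp; norm_num
  have : 0 < 1 / (2 * (d : ℝ)) := by positivity
  linarith

lemma one_le_norm_add {c : ℝ} (hc : 1 ≤ c) {z : ℂ} (hz : 0 ≤ z.re) : 1 ≤ ‖z + c‖ := by
  refine le_trans ?_ (Complex.re_le_norm _)
  simp; linarith

/-- A holomorphic logarithm of the Laplace transform of `weightFunction d c`. -/
noncomputable def logLaplace (d : ℕ) (c : ℝ) (z : ℂ) : ℂ :=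
  ((Real.log ((2 * Real.pi) ^ (d / 2 : ℝ)) : ℝ) : ℂ) +
    Complex.log (z + c) * ((-(d / 2 + 1) : ℝ) : ℂ) +
    Complex.log (Complex.betaIntegral (betaArgument d c z) (1 / 2))

lemma one_le_of_weight_bound {d : ℕ} {c : ℝ} (hc : 1 + 3 / (2 * (d : ℝ)) ≤ c) : 1 ≤ c := by
  have : 0 ≤ 3 / (2 * (d : ℝ)) := by positivity
  linarith

lemma laplaceTransform_weightFunction_eq_exp {d : ℕ} (hd : 1 ≤ d) {c : ℝ}
    (hc : 1 + 3 / (2 * (d : ℝ)) ≤ c) {z : ℂ} (hz : 0 ≤ z.re) :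
    laplaceTransform (weightFunction d c) z = Complex.exp (logLaplace d c z) := by
  have hα : 0 < (betaArgument d c z).re :=
    lt_of_lt_of_le (by norm_num) (quarter_le_re_betaArgument hd hc hz)
  have hzc : z + c ≠ 0 :=
    norm_pos_iff.1 (zero_lt_one.trans_le (one_le_norm_add (one_le_of_weight_bound hc) hz))
  rw [laplaceTransform_weightFunction hd ((abscissa_neg hd hc).trans_le hz), logLaplace,
    Complex.exp_add, Complex.exp_add, Complex.exp_log (betaIntegral_half_ne_zero hα),
    Complex.cpow_def_of_ne_zero hzc, ← Complex.ofReal_exp, Real.exp_log (by positivity)]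

lemma differentiableAt_logLaplace {d : ℕ} (hd : 1 ≤ d) {c : ℝ}
    (hc : 1 + 3 / (2 * (d : ℝ)) ≤ c) {z : ℂ} (hz : 0 ≤ z.re) :
    DifferentiableAt ℂ (logLaplace d c) z := by
  have hα : 0 < (betaArgument d c z).re :=
    lt_of_lt_of_le (by norm_num) (quarter_le_re_betaArgument hd hc hz)
  have hzc : z + c ∈ Complex.slitPlane :=
    Or.inl (by simpa using add_pos_of_nonneg_of_pos hz (zero_lt_one.trans_le (one_le_of_weight_bound hc)))
  have h1 : DifferentiableAt ℂ (fun z : ℂ => Complex.log (z + c)) z :=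
    DifferentiableAt.clog (by fun_prop) hzc
  have h2 : DifferentiableAt ℂ (fun z : ℂ =>
      Complex.log (Complex.betaIntegral (betaArgument d c z) (1 / 2))) z :=
    DifferentiableAt.clog (DifferentiableAt.comp (f := betaArgument d c) z
      (differentiableAt_betaIntegral_half hα) (differentiable_betaArgument d c z))
      (betaIntegral_half_mem_slitPlane hα)
  exact ((h1.mul_const _).const_add _).add h2

/-- Each logarithm grows logarithmically and has argument at most `π`, well within the square-root
growth that `isOuter_of_eq_exp` allows. -/
lemma exists_norm_logLaplace_le {d : ℕ} (hd : 1 ≤ d) {c : ℝ}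
    (hc : 1 + 3 / (2 * (d : ℝ)) ≤ c) :
    ∃ K : ℝ, ∀ z : ℂ, 0 ≤ z.re → ‖logLaplace d c z‖ ≤ K * √(1 + ‖z‖) := by
  obtain ⟨M, hM⟩ := exists_norm_log_betaIntegral_half_le (a := 1 / 4) (by norm_num)
  have hc1 := one_le_of_weight_bound hc
  set K₀ := |Real.log ((2 * Real.pi) ^ (d / 2 : ℝ))|
  set K₁ := |Real.log 1| + 2 * √(1 + c)
  set L : ℝ := d / 2 + ‖betaArgument d c 0‖ with hL
  set K₂ := |Real.log (1 / 4)| + 2 * √L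
  refine ⟨K₀ + (K₁ + Real.pi) * ((d : ℝ) / 2 + 1) + (|M| + K₂), fun z hz => ?_⟩
  have hs : 1 ≤ √(1 + ‖z‖) := Real.one_le_sqrt.2 (by linarith [norm_nonneg z])
  set S := √(1 + ‖z‖)
  have hlog : ‖Complex.log (z + c)‖ ≤ (K₁ + Real.pi) * S := by
    have h1 : |Real.log ‖z + c‖| ≤ K₁ * S := by
      refine abs_log_norm_le_mul_sqrt one_pos (one_le_norm_add hc1 hz) ?_
      refine (norm_add_le _ _).trans ?_
      rw [Complex.norm_real, Real.norm_of_nonneg (by linarith)]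
      nlinarith [norm_nonneg z]
    refine (Complex.norm_le_abs_re_add_abs_im _).trans ?_
    rw [Complex.log_re, Complex.log_im]
    nlinarith [Complex.abs_arg_le_pi (z + c), Real.pi_pos]
  have hα := quarter_le_re_betaArgument hd hc hz
  have hbeta : ‖Complex.log (Complex.betaIntegral (betaArgument d c z) (1 / 2))‖ ≤
      (|M| + K₂) * S := by
    have h1 : |Real.log ‖betaArgument d c z‖| ≤ K₂ * S := by
      refine abs_log_norm_le_mul_sqrt (by norm_num) (hα.trans (Complex.re_le_norm _)) ?_
      have e : betaArgument d c z = (d : ℂ) / 2 * z + betaArgument d c 0 := by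
        simp only [betaArgument]; ring
      rw [e]
      refine (norm_add_le _ _).trans ?_
      rw [norm_mul, norm_div, Complex.norm_natCast, Complex.norm_ofNat, hL]
      nlinarith [mul_nonneg (norm_nonneg (betaArgument d c 0)) (norm_nonneg z),
        (Nat.cast_nonneg d : (0 : ℝ) ≤ d)]
    have h2 := hM _ hα
    nlinarith [le_abs_self M, abs_nonneg M]
  have hconst : ‖((Real.log ((2 * Real.pi) ^ (d / 2 : ℝ)) : ℝ) : ℂ)‖ ≤ K₀ * S := by
    rw [Complex.norm_real]
    exact le_mul_of_one_le_right (abs_nonneg _) hs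
  have hmul : ‖Complex.log (z + c) * ((-(d / 2 + 1) : ℝ) : ℂ)‖ ≤
      (K₁ + Real.pi) * S * ((d : ℝ) / 2 + 1) := by
    rw [norm_mul, Complex.norm_real, norm_neg, Real.norm_of_nonneg (by positivity)]
    gcongr
  rw [logLaplace]
  refine (norm_add₃_le).trans ?_
  linarith

/-- The Beta factor is bounded, and since `‖z + c‖ ≥ 1` the power `-(d/2 + 1)` may be weakened to
`-1`, still square integrable on vertical lines. -/
lemma exists_norm_laplaceTransform_weightFunction_le {d : ℕ} (hd : 1 ≤ d) {c : ℝ}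
    (hc : 1 + 3 / (2 * (d : ℝ)) ≤ c) :
    ∃ C : ℝ, 0 ≤ C ∧ ∀ z : ℂ, 0 ≤ z.re →
      ‖laplaceTransform (weightFunction d c) z‖ ≤ C * ‖z + c‖⁻¹ := by
  obtain ⟨M, hM0, hM⟩ := exists_norm_betaIntegral_half_le (a := 1 / 4) (by norm_num)
  refine ⟨(2 * Real.pi) ^ (d / 2 : ℝ) * M, by positivity, fun z hz => ?_⟩
  have h1 := one_le_norm_add (one_le_of_weight_bound hc) hz
  have h2 := hM _ (quarter_le_re_betaArgument hd hc hz)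
  rw [laplaceTransform_weightFunction hd ((abscissa_neg hd hc).trans_le hz), norm_mul, norm_mul,
    Complex.norm_cpow_real, Complex.norm_real, Real.norm_of_nonneg (by positivity)]
  have h3 : ‖z + c‖ ^ (-(d / 2 + 1) : ℝ) ≤ ‖z + c‖⁻¹ := by
    rw [← Real.rpow_neg_one]
    refine Real.rpow_le_rpow_of_exponent_le h1 ?_
    linarith [(by positivity : (0 : ℝ) ≤ (d : ℝ) / 2)]
  calc _ ≤ (2 * Real.pi) ^ (d / 2 : ℝ) * ‖z + c‖⁻¹ * M := by gcongr
    _ = _ := by ring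

theorem memHardyTwo_laplaceTransform_weightFunction {d : ℕ} (hd : 1 ≤ d) {c : ℝ}
    (hc : 1 + 3 / (2 * (d : ℝ)) ≤ c) :
    MemHardyTwo (laplaceTransform (weightFunction d c)) := by
  obtain ⟨C, hC0, hC⟩ := exists_norm_laplaceTransform_weightFunction_le hd hc
  have hc1 := one_le_of_weight_bound hc
  refine ⟨(differentiableOn_laplaceTransform_weightFunction hd c).mono
    fun z hz => (abscissa_neg hd hc).trans hz, ?_⟩
  have hint : Integrable fun y : ℝ => C ^ 2 * (1 + y ^ 2)⁻¹ :=
    integrable_inv_one_add_sq.const_mul _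
  refine lt_of_le_of_lt (iSup₂_le fun x hx => ?_) hint.lintegral_lt_top
  refine lintegral_mono fun y => ?_
  have hz : 0 ≤ ((x : ℂ) + y * Complex.I).re := by simpa using hx.le
  rw [← ofReal_norm, ← ENNReal.ofReal_pow (norm_nonneg _)]
  refine ENNReal.ofReal_le_ofReal ?_
  have h1 := hC _ hz
  -- As `x > 0` and `c ≥ 1`, the majorant does not depend on `x`, which gives the supremum bound.
  have h2 : 1 + y ^ 2 ≤ ‖(x : ℂ) + y * Complex.I + c‖ ^ 2 := by
    rw [← Complex.normSq_eq_norm_sq, Complex.normSq_apply]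
    simp only [Complex.add_re, Complex.ofReal_re, Complex.mul_re, Complex.I_re, mul_zero,
      Complex.ofReal_im, Complex.I_im, mul_one, sub_self, add_zero, Complex.add_im,
      Complex.mul_im, zero_add]
    nlinarith
  calc _ ≤ (C * ‖(x : ℂ) + y * Complex.I + c‖⁻¹) ^ 2 := by gcongr
    _ = C ^ 2 * (‖(x : ℂ) + y * Complex.I + c‖ ^ 2)⁻¹ := by rw [mul_pow, inv_pow]
    _ ≤ C ^ 2 * (1 + y ^ 2)⁻¹ := by gcongr

theorem isOuter_laplaceTransform_weightFunction {d : ℕ} (hd : 1 ≤ d) {c : ℝ}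
    (hc : 1 + 3 / (2 * (d : ℝ)) ≤ c) :
    IsOuter (laplaceTransform (weightFunction d c)) := by
  obtain ⟨K, hK⟩ := exists_norm_logLaplace_le hd hc
  exact isOuter_of_eq_exp (fun _ hw => differentiableAt_logLaplace hd hc hw) hK
    fun _ hw => laplaceTransform_weightFunction_eq_exp hd hc hw

theorem corollary5p2 (d : ℕ) (hd : 1 ≤ d) (c : ℝ) (hc : 1 + 3 / (2 * (d : ℝ)) ≤ c) :
    (∀ lam : ℝ, 0 < lam → gaussianDistribution d lam < ⊤) ∧
    (∀ z ∈ rightHalfPlane, IntegrableOn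
      (fun k : ℝ => Complex.exp (-((k : ℂ) * z)) * (weightFunction d c k : ℂ)) (Set.Ioi 0)) ∧
    MemHardyTwo (laplaceTransform (weightFunction d c)) ∧
    IsOuter (laplaceTransform (weightFunction d c)) :=
  ⟨fun _ hlam => gaussianDistribution_lt_top hd hlam,
    fun _ hz => integrableOn_exp_mul_weightFunction hd ((abscissa_neg hd hc).trans hz),
    memHardyTwo_laplaceTransform_weightFunction hd hc,
    isOuter_laplaceTransform_weightFunction hd hc⟩
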